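/- **Setting.** For each $n\ge 1$ let $W=W^{(n)}=\{W^{(n)}_{jk}\}_{j,k=1}^n$ be a real symmetric random matrix whose entries $W^{(n)}_{jk}$, $1\le j\le k\le n$, are independent with $$\mathbf E\{W^{(n)}_{jk}\}=0,\qquad \mathbf E\{(W^{(n)}_{jk})^2\}=(1+\delta_{jk})w^2,$$ where $w$ does not depend on $n$. Assume that the third and fourth moments exist and do not depend on $j,k,n$: $$\mu_3=\mathbf E\{(W^{(n)}_{jk})^3\},\qquad \mu_4=\mathbf E\{(W^{(n)}_{jk})^4\},$$ and that the Lindeberg-type condition $$\lim_{n\to\infty}\frac1{n^2}\sum_{j,k=1}^n\mathbf E\big\{(W^{(n)}_{jk})^4\,\mathbf 1_{|W^{(n)}_{jk}|>\tau\sqrt n}\big\}=0\qquad\text{for all }\tau>0$$ holds. For $\tau>0$ define the truncated matrix $$M^\tau=n^{-1/2}\big\{\operatorname{sign}(W^{(n)}_{jk})\,\min(|W^{(n)}_{jk}|,\tau\sqrt n)\big\}_{j,k=1}^n,$$ and put $u_{n\tau}(t)=\operatorname{Tr}e^{itM^\tau}$ for $t\in\mathbb R$ and $\mathcal N_{n\tau}[\varphi]=\sum_{l=1}^n\varphi(\lambda_l)$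 for $\varphi:\mathbb R\to\mathbb C$, where $\lambda_1,\dots,\lambda_n$ are the eigenvalues of $M^\tau$ counted with multiplicity. For a complex random variable, $\mathbf{Var}\{X\}=\mathbf E\{|X-\mathbf E X|^2\}$. **Theorem.** There is a number $C_\tau(\mu_4)$ depending only on $\tau$ and $\mu_4$ such that, for all matrices as above, all $\tau>0$ and all $n$, the random variables below are square integrable and the following bounds hold. 1. For every $t\in\mathbb R$, $$\mathbf{Var}\{u_{n\tau}(t)\}\le C_\tau(\mu_4)\,(1+|t|^4)^2 .$$ 2. For every continuous integrable $\varphi:\mathbb R\to\mathbb C$ whose Fourier transform $\widehat\varphi(t)=\frac1{2\pi}\int e^{-it\lambda}\varphi(\lambda)\,d\lambda$ satisfies $\int(1+|t|^4)|\widehat\varphi(t)|\,dt<\infty$, $$\mathbf{Var}\{\mathcal N_{n\tau}[\varphi]\}\le C_\tau(\mu_4)\Big(\int(1+|t|^4)\,|\widehat\varphi(t)|\,dt\Big)^2 .$$ The same bound holds for every $\varphi$, integrable or not, of the form $\varphi(\lambda)=\int e^{it\lambda}\widehat\varphi(t)\,dt$ for all $\lambda\in\mathbb R$, with a measurable $\widehat\varphi:\mathbb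 R\to\mathbb C$ such that $\int(1+|t|^4)|\widehat\varphi(t)|\,dt<\infty$. -/

import Mathlib

open MeasureTheory ProbabilityTheory Filter Topology

noncomputable section

/-- The variance `E{|X - E X|²}` of a complex random variable. -/
def complexVar {Ω : Type*} [MeasurableSpace Ω] (X : Ω → ℂ) (P : Measure Ω) : ℝ :=
  ∫ ω, ‖X ω - ∫ ω', X ω' ∂P‖ ^ 2 ∂P

/-- A sequence `W n` of `n × n` real symmetric random matrices (each on its own probability
space) whose entries on and above the diagonal are independent, have mean zero and variance
`(1 + δ_{jk}) w²`. The Wigner matrix itself is `n^{-1/2} W n`. -/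
structure IsWigner {Ω : ℕ → Type*} [∀ n, MeasurableSpace (Ω n)] (P : ∀ n, Measure (Ω n))
    (w : ℝ) (W : ∀ n, Ω n → Matrix (Fin n) (Fin n) ℝ) : Prop where
  symm : ∀ n ω, (W n ω).IsSymm
  measurable_entry : ∀ n j k, Measurable fun ω => W n ω j k
  indep : ∀ n, iIndepFun
    (fun (p : {p : Fin n × Fin n // p.1 ≤ p.2}) ω => W n ω p.1.1 p.1.2) (P n)
  sq_integrable : ∀ n j k, MemLp (fun ω => W n ω j k) 2 (P n)
  mean : ∀ n j k, ∫ ω, W n ω j k ∂(P n) = 0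
  second_moment : ∀ n j k, ∫ ω, (W n ω j k) ^ 2 ∂(P n) = (1 + if j = k then 1 else 0) * w ^ 2

/-- The third and fourth moments of the entries exist, and equal `μ₃` and `μ₄` for all
`j`, `k` and `n`. -/
structure HasMoments {Ω : ℕ → Type*} [∀ n, MeasurableSpace (Ω n)] (P : ∀ n, Measure (Ω n))
    (W : ∀ n, Ω n → Matrix (Fin n) (Fin n) ℝ) (μ₃ μ₄ : ℝ) : Prop where
  fourth_integrable : ∀ n j k, MemLp (fun ω => W n ω j k) 4 (P n)
  third : ∀ n j k, ∫ ω, (W n ω j k) ^ 3 ∂(P n) = μ₃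
  fourth : ∀ n j k, ∫ ω, (W n ω j k) ^ 4 ∂(P n) = μ₄

/-- `L_n^{(4)}(τ) = n^{-2} ∑_{j,k} E{W_{jk}⁴ ; |W_{jk}| > τ √n}`. -/
def lindebergFourth {Ω : ℕ → Type*} [∀ n, MeasurableSpace (Ω n)] (P : ∀ n, Measure (Ω n))
    (W : ∀ n, Ω n → Matrix (Fin n) (Fin n) ℝ) (τ : ℝ) (n : ℕ) : ℝ :=
  1 / (n : ℝ) ^ 2 *
    ∑ j, ∑ k, ∫ ω in {ω | τ * √(n : ℝ) < |W n ω j k|}, (W n ω j k) ^ 4 ∂(P n)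

/-- The truncated matrix `M^τ = n^{-1/2} {sign(W_{jk}) min(|W_{jk}|, τ √n)}`. -/
def truncatedMatrix {n : ℕ} (τ : ℝ) (W : Matrix (Fin n) (Fin n) ℝ) :
    Matrix (Fin n) (Fin n) ℝ :=
  Matrix.of fun j k => (√(n : ℝ))⁻¹ * (Real.sign (W j k) * min |W j k| (τ * √(n : ℝ)))

theorem truncatedMatrix_isHermitian {n : ℕ} (τ : ℝ) {W : Matrix (Fin n) (Fin n) ℝ}
    (hW : W.IsSymm) : (truncatedMatrix τ W).IsHermitian := by
  ext j k
  simp [truncatedMatrix, hW.apply j k]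

/-- `Tr exp(i t A)` for a real matrix `A`. -/
def traceExp {n : ℕ} (A : Matrix (Fin n) (Fin n) ℝ) (t : ℝ) : ℂ :=
  (NormedSpace.exp ((Complex.I * (t : ℂ)) • A.map (fun x : ℝ => (x : ℂ)))).trace

/-- The linear eigenvalue statistic `∑_l φ(λ_l)` of a real symmetric matrix, the eigenvalues
being counted with multiplicity. -/
def linearStatistic {n : ℕ} (φ : ℝ → ℂ) {A : Matrix (Fin n) (Fin n) ℝ}
    (hA : A.IsHermitian) : ℂ :=
  ∑ l, φ (hA.eigenvalues l)

/-- The Fourier transform `φ̂(t) = (2π)⁻¹ ∫ e^{-itx} φ(x) dx`. -/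
def fourierHat (φ : ℝ → ℂ) (t : ℝ) : ℂ :=
  1 / (2 * (Real.pi : ℂ)) * ∫ x : ℝ, Complex.exp (-(Complex.I * t * x)) * φ x

end

/-! ### The Efron–Stein inequality -/

/-! The trace of the exponential is a bounded function of the independent entries on and above the
diagonal, so the Efron–Stein inequality (`efronStein`) bounds its variance by the sum over positions
`p` of the mean square change when the entry `x p` is set to zero. By Duhamel's formula that change
is `i t x_p Tr(E_p U_p)` up to an error `O(t² x_p²)`, where `E_p` is the symmetric matrix unit and
`U_p` the exponential with the entry already removed (`norm_traceExp_sub_update_le`). Since `U_p` is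
independent of `x p`, the mean of `x_p² |Tr(E_p U_p)|²` factorizes. Replacing `U_p` by the full
exponential `U` costs another second-order error, and unitarity gives `∑_p |Tr(E_p U)|² ≤ 4n`
(`sum_norm_trace_symmUnit_mul_sq_le`). With second moments `O(w²/n)` and fourth moments `O(μ₄/n²)`,
the first-order terms sum to `O(t² w²)` and the `O(n²)` errors to `O(t⁴ (w⁴ + μ₄))`. Truncation only
shrinks the entries, so these moment bounds survive it; centring is not needed because only even
moments enter. Finally `4 w⁴ ≤ μ₄` eliminates `w`. A linear statistic is the integral of these
traces against the Fourier density, and its standard deviation is at most the integral of theirs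
(`complexVar_integral_mul_le`). -/

theorem integrable_of_norm_le {α E : Type*} [MeasurableSpace α] [NormedAddCommGroup E]
    [MeasurableSpace E] [BorelSpace E] [SecondCountableTopology E]
    (μ : Measure α) [IsFiniteMeasure μ]
    {g : α → E} (hg : Measurable g) {K : ℝ} (hK : ∀ x, ‖g x‖ ≤ K) : Integrable g μ :=
  Integrable.of_bound hg.aestronglyMeasurable K (ae_of_all _ hK)

theorem integrable_norm_sq_of_norm_le {α : Type*} [MeasurableSpace α]
    (μ : Measure α) [IsFiniteMeasure μ]
    {g : α → ℂ} (hg : Measurable g) {K : ℝ} (hK : ∀ x, ‖g x‖ ≤ K) :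
    Integrable (fun x => ‖g x‖ ^ 2) μ := by
  refine integrable_of_norm_le μ (by fun_prop) (K := K ^ 2) fun x => ?_
  rw [norm_pow, norm_norm]
  exact pow_le_pow_left₀ (norm_nonneg _) (hK x) 2

/-- Bias–variance decomposition: the cross term is linear in `g - m` and integrates to zero. -/
theorem integral_norm_sub_sq_eq {α : Type*} [MeasurableSpace α] (μ : Measure α)
    [IsProbabilityMeasure μ] {g : α → ℂ} (hg : Measurable g) {K : ℝ} (hK : ∀ x, ‖g x‖ ≤ K)
    (c : ℂ) :
    ∫ x, ‖g x - c‖ ^ 2 ∂μ = ∫ x, ‖g x - ∫ y, g y ∂μ‖ ^ 2 ∂μ + ‖∫ y, g y ∂μ - c‖ ^ 2 := by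
  set m := ∫ y, g y ∂μ with hm
  have hgi : Integrable g μ := integrable_of_norm_le μ hg hK
  have hbd : ∀ x, ‖g x - m‖ ≤ K + ‖m‖ := fun x =>
    (norm_sub_le _ _).trans (add_le_add (hK x) le_rfl)
  have hi1 : Integrable (fun x => ‖g x - m‖ ^ 2) μ :=
    integrable_norm_sq_of_norm_le μ (by fun_prop) hbd
  have hi2 : Integrable (fun x => (g x - m) * (starRingEnd ℂ) (m - c)) μ :=
    (hgi.sub (integrable_const _)).mul_const _
  have hi3 : Integrable (fun x => 2 * ((g x - m) * (starRingEnd ℂ) (m - c)).re) μ :=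
    hi2.re.const_mul 2
  have hpt : ∀ x, ‖g x - c‖ ^ 2
      = ‖g x - m‖ ^ 2 + 2 * ((g x - m) * (starRingEnd ℂ) (m - c)).re + ‖m - c‖ ^ 2 := by
    intro x
    simp only [← Complex.normSq_eq_norm_sq, Complex.normSq_apply, Complex.sub_re, Complex.sub_im,
      Complex.mul_re, Complex.conj_re, Complex.conj_im]
    ring
  have hz : ∫ x, ((g x - m) * (starRingEnd ℂ) (m - c)).re ∂μ = 0 := by
    have h := integral_re hi2
    simp only [RCLike.re_to_complex] at h
    rw [h, integral_mul_const, integral_sub hgi (integrable_const _)]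
    simp [← hm]
  simp_rw [hpt]
  rw [integral_add (f := fun x => ‖g x - m‖ ^ 2 + 2 * ((g x - m) * (starRingEnd ℂ) (m - c)).re)
    (hi1.add hi3) (integrable_const _), integral_add hi1 hi3, integral_const_mul, hz]
  simp

theorem integral_norm_sub_integral_sq_le {α : Type*} [MeasurableSpace α] (μ : Measure α)
    [IsProbabilityMeasure μ] {g : α → ℂ} (hg : Measurable g) {K : ℝ} (hK : ∀ x, ‖g x‖ ≤ K)
    (c : ℂ) :
    ∫ x, ‖g x - ∫ y, g y ∂μ‖ ^ 2 ∂μ ≤ ∫ x, ‖g x - c‖ ^ 2 ∂μ := by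
  rw [integral_norm_sub_sq_eq μ hg hK c]
  exact le_add_of_nonneg_right (by positivity)

theorem norm_integral_sq_le {α : Type*} [MeasurableSpace α] (μ : Measure α)
    [IsProbabilityMeasure μ] {g : α → ℂ} (hg : Measurable g) {K : ℝ} (hK : ∀ x, ‖g x‖ ≤ K) :
    ‖∫ y, g y ∂μ‖ ^ 2 ≤ ∫ x, ‖g x‖ ^ 2 ∂μ := by
  have h := integral_norm_sub_sq_eq μ hg hK 0
  simp only [sub_zero] at h
  rw [h]
  exact le_add_of_nonneg_left (integral_nonneg fun _ => by positivity)

theorem integral_pi_succ {m : ℕ} (μ : Fin (m + 1) → Measure ℝ) [∀ i, IsProbabilityMeasure (μ i)]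
    {E : Type*} [NormedAddCommGroup E] [NormedSpace ℝ E] (g : (Fin (m + 1) → ℝ) → E) :
    ∫ x, g x ∂(Measure.pi μ)
      = ∫ z, g (Fin.cons z.1 z.2) ∂((μ 0).prod (Measure.pi fun i : Fin m => μ i.succ)) := by
  have h := (measurePreserving_piFinSuccAbove μ 0).symm
  rw [← h.integral_comp' (g := g)]
  simp [MeasurableEquiv.piFinSuccAbove, Fin.insertNthEquiv, Fin.zero_succAbove]

/-- The Efron–Stein inequality for a bounded function of independent coordinates. -/
theorem efronStein_pi : ∀ (m : ℕ) (μ : Fin m → Measure ℝ) [∀ i, IsProbabilityMeasure (μ i)]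
    {f : (Fin m → ℝ) → ℂ} (_ : Measurable f) {K : ℝ} (_ : ∀ x, ‖f x‖ ≤ K),
    ∫ x, ‖f x - ∫ y, f y ∂(Measure.pi μ)‖ ^ 2 ∂(Measure.pi μ)
      ≤ ∑ i, ∫ x, ‖f x - f (Function.update x i 0)‖ ^ 2 ∂(Measure.pi μ)
  | 0, μ, _, f, hf, K, hK => by
    have h : ∀ x, f x = f default := fun x => by rw [Subsingleton.elim x default]
    simp [h]
  | m + 1, μ, _, f, hf, K, hK => by
    set ν : Measure (Fin m → ℝ) := Measure.pi fun i : Fin m => μ i.succ with hν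
    have hcons : Measurable fun z : ℝ × (Fin m → ℝ) => (Fin.cons z.1 z.2 : Fin (m + 1) → ℝ) := by
      refine measurable_pi_lambda _ fun i => ?_
      refine Fin.cases ?_ (fun j => ?_) i
      · simpa using measurable_fst
      · simp only [Fin.cons_succ]
        exact (measurable_pi_apply j).comp measurable_snd
    set F : ℝ → (Fin m → ℝ) → ℂ := fun a y => f (Fin.cons a y) with hF
    have hFm : Measurable fun z : ℝ × (Fin m → ℝ) => F z.1 z.2 := hf.comp hcons
    have hFm1 : ∀ y, Measurable fun a => F a y := fun y =>
      hFm.comp (measurable_id.prodMk measurable_const)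
    have hFm2 : ∀ a, Measurable fun y => F a y := fun a =>
      hFm.comp (measurable_const.prodMk measurable_id)
    have hFb : ∀ a y, ‖F a y‖ ≤ K := fun a y => hK _
    set h : (Fin m → ℝ) → ℂ := fun y => ∫ a, F a y ∂(μ 0) with hh
    have hhm : Measurable h := by
      have : StronglyMeasurable h :=
        StronglyMeasurable.integral_prod_left (f := F) hFm.stronglyMeasurable
      exact this.measurable
    have hhb : ∀ y, ‖h y‖ ≤ K := fun y => by
      simpa using norm_integral_le_of_norm_le_const (μ := μ 0) (ae_of_all _ fun a => hFb a y)
    have hup : ∀ i, Measurable fun x : Fin m → ℝ => Function.update x i 0 := fun i =>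
      measurable_update_left
    have hc : ∫ y, f y ∂(Measure.pi μ) = ∫ y, h y ∂ν := by
      rw [integral_pi_succ]
      exact integral_prod_symm (fun z : ℝ × (Fin m → ℝ) => F z.1 z.2)
        (integrable_of_norm_le _ hFm fun z => hFb _ _)
    have hswap : ∀ (G : ℝ → (Fin m → ℝ) → ℂ) (L : ℝ),
        (Measurable fun z : ℝ × (Fin m → ℝ) => G z.1 z.2) → (∀ a y, ‖G a y‖ ≤ L) →
        Integrable (fun y => ∫ a, ‖G a y‖ ^ 2 ∂(μ 0)) ν ∧
        ∫ z, ‖G z.1 z.2‖ ^ 2 ∂((μ 0).prod ν) = ∫ y, ∫ a, ‖G a y‖ ^ 2 ∂(μ 0) ∂ν ∧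
        ∫ z, ‖G z.1 z.2‖ ^ 2 ∂((μ 0).prod ν) = ∫ a, ∫ y, ‖G a y‖ ^ 2 ∂ν ∂(μ 0) := by
      intro G L hG hL
      have hi := integrable_norm_sq_of_norm_le ((μ 0).prod ν) hG (fun z => hL z.1 z.2)
      exact ⟨hi.integral_prod_right, integral_prod_symm _ hi, integral_prod _ hi⟩
    rw [Fin.sum_univ_succ, integral_pi_succ, hc]
    simp_rw [integral_pi_succ, Fin.update_cons_zero, ← Fin.cons_update]
    obtain ⟨hi1, he1, -⟩ := hswap (fun a y => F a y - ∫ y, h y ∂ν) (K + ‖∫ y, h y ∂ν‖)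
      (by fun_prop) (fun a y => (norm_sub_le _ _).trans (add_le_add (hFb _ _) le_rfl))
    obtain ⟨hi2, he2, -⟩ := hswap (fun a y => F a y - F 0 y) (K + K)
      (hFm.sub ((hFm2 0).comp measurable_snd))
      (fun a y => (norm_sub_le _ _).trans (add_le_add (hFb _ _) (hFb _ _)))
    have hbi : Integrable (fun y => ‖h y - ∫ y, h y ∂ν‖ ^ 2) ν :=
      integrable_norm_sq_of_norm_le ν (by fun_prop)
        (fun y => (norm_sub_le _ _).trans (add_le_add (hhb y) le_rfl))
    -- For fixed `y`, bias–variance separates the conditional variance in `a` from the deviation of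
    -- the conditional mean `h y`. The mean is the best constant, so `F 0 y` may replace it in the
    -- first term.
    have hsplit : ∫ y, ∫ a, ‖F a y - ∫ y, h y ∂ν‖ ^ 2 ∂(μ 0) ∂ν
        ≤ ∫ y, ∫ a, ‖F a y - F 0 y‖ ^ 2 ∂(μ 0) ∂ν + ∫ y, ‖h y - ∫ y, h y ∂ν‖ ^ 2 ∂ν := by
      rw [← integral_add hi2 hbi]
      refine integral_mono hi1 (hi2.add hbi) fun y => ?_
      show ∫ a, ‖F a y - ∫ y, h y ∂ν‖ ^ 2 ∂(μ 0) ≤ _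
      rw [integral_norm_sub_sq_eq (μ 0) (hFm1 y) (fun a => hFb a y)]
      exact add_le_add (integral_norm_sub_integral_sq_le (μ 0) (hFm1 y) (fun a => hFb a y) _) le_rfl
    refine he1.trans_le (hsplit.trans (add_le_add he2.ge ?_))
    -- The conditional mean `h` has one coordinate fewer, so induction applies; by Jensen, averaging
    -- over `a` does not increase its squared increments.
    refine (efronStein_pi m (fun i => μ i.succ) hhm hhb).trans
      (Finset.sum_le_sum fun i _ => ?_)
    have hGm : Measurable fun z : ℝ × (Fin m → ℝ) => F z.1 z.2 - F z.1 (Function.update z.2 i 0) :=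
      hFm.sub (hFm.comp (measurable_fst.prodMk ((hup i).comp measurable_snd)))
    have hGb : ∀ a y, ‖F a y - F a (Function.update y i 0)‖ ≤ K + K := fun a y =>
      (norm_sub_le _ _).trans (add_le_add (hFb _ _) (hFb _ _))
    obtain ⟨hi3, he3, -⟩ := hswap (fun a y => F a y - F a (Function.update y i 0)) (K + K) hGm hGb
    refine le_of_le_of_eq ?_ he3.symm
    refine integral_mono (integrable_norm_sq_of_norm_le ν (hhm.sub (hhm.comp (hup i)))
      (fun y => (norm_sub_le _ _).trans (add_le_add (hhb _) (hhb _)))) hi3 fun y => ?_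
    show ‖h y - h (Function.update y i 0)‖ ^ 2 ≤ _
    rw [hh]
    dsimp only
    rw [← integral_sub (integrable_of_norm_le _ (hFm1 y) (fun a => hFb a y))
      (integrable_of_norm_le _ (hFm1 _) (fun a => hFb a _))]
    exact norm_integral_sq_le (μ 0) ((hFm1 y).sub (hFm1 _)) (fun a => hGb a y)

/-- The Efron–Stein inequality for a bounded function of a finite family of independent real
random variables. -/
theorem efronStein {Ω ι : Type*} [MeasurableSpace Ω] [Fintype ι] [DecidableEq ι] (P : Measure Ω)
    [IsProbabilityMeasure P] {X : ι → Ω → ℝ} (hX : ∀ i, Measurable (X i)) (hind : iIndepFun X P)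
    {f : (ι → ℝ) → ℂ} (hf : Measurable f) {K : ℝ} (hK : ∀ x, ‖f x‖ ≤ K) :
    ∫ ω, ‖f (fun i => X i ω) - ∫ ω', f (fun i => X i ω') ∂P‖ ^ 2 ∂P
      ≤ ∑ i, ∫ ω, ‖f (fun i => X i ω) - f (Function.update (fun i => X i ω) i 0)‖ ^ 2 ∂P := by
  set e := (Fintype.equivFin ι).symm
  have hY : ∀ j, Measurable (X (e j)) := fun j => hX _
  have hYm : Measurable fun ω j => X (e j) ω := measurable_pi_lambda _ hY
  have hmap := (iIndepFun_iff_map_fun_eq_pi_map (fun j => (hY j).aemeasurable)).1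
    (hind.precomp e.injective)
  have : ∀ j, IsProbabilityMeasure (P.map (X (e j))) := fun j =>
    Measure.isProbabilityMeasure_map (hY j).aemeasurable
  have hcomp : Measurable fun (y : Fin (Fintype.card ι) → ℝ) (i : ι) => y (e.symm i) :=
    measurable_pi_lambda _ fun i => measurable_pi_apply _
  have h := efronStein_pi _ (fun j => P.map (X (e j))) (hf.comp hcomp) (fun y => hK _)
  rw [← hmap] at h
  have hsq : ∀ {g : (Fin (Fintype.card ι) → ℝ) → ℂ}, Measurable g → AEStronglyMeasurable
      (fun x => ‖g x‖ ^ 2) (P.map fun ω j => X (e j) ω) := fun hg =>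
    (hg.norm.pow_const 2).aestronglyMeasurable
  have hupd : ∀ j : Fin (Fintype.card ι),
      Measurable fun x : Fin (Fintype.card ι) → ℝ => Function.update x j 0 := fun j =>
    measurable_update_left
  rw [integral_map hYm.aemeasurable (hf.comp hcomp).aestronglyMeasurable,
    integral_map hYm.aemeasurable (hsq ((hf.comp hcomp).sub_const _))] at h
  simp only [Function.comp_apply, Equiv.apply_symm_apply] at h
  refine h.trans_eq ?_
  rw [← e.sum_comp]
  refine Finset.sum_congr rfl fun j _ => ?_
  have h2 : Measurable fun x : Fin (Fintype.card ι) → ℝ =>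
      f (fun i => x (e.symm i)) - f (fun i => Function.update x j 0 (e.symm i)) :=
    (hf.comp hcomp).sub ((hf.comp hcomp).comp (hupd j))
  rw [integral_map hYm.aemeasurable (hsq h2)]
  refine integral_congr_ae (ae_of_all _ fun ω => ?_)
  simp only [Equiv.apply_symm_apply]
  congr 4
  ext i
  obtain ⟨k, rfl⟩ := e.surjective i
  by_cases hk : k = j
  · subst hk; simp
  · rw [Function.update_of_ne (by simpa using hk), Function.update_of_ne (by simpa using hk)]
    simp

/-! ### Exponentials of skew-adjoint elements -/

section SkewAdjoint

variable {A : Type*} [CStarAlgebra A]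

theorem norm_le_one_of_mem_unitary {u : A} (hu : u ∈ unitary A) : ‖u‖ ≤ 1 := by
  nontriviality A
  exact (CStarRing.norm_of_mem_unitary hu).le

theorem exp_mem_unitary_of_star_eq_neg {x : A} (hx : star x = -x) :
    NormedSpace.exp x ∈ unitary A := by
  let +nondep : NormedAlgebra ℚ A := .restrictScalars ℚ ℂ A
  exact NormedSpace.exp_mem_unitary_of_mem_skewAdjoint (skewAdjoint.mem_iff.2 hx)

theorem norm_exp_smul_le_one {x : A} (hx : star x = -x) (r : ℝ) :
    ‖NormedSpace.exp (r • x)‖ ≤ 1 :=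
  norm_le_one_of_mem_unitary (exp_mem_unitary_of_star_eq_neg (by rw [star_smul, hx]; simp))

/-- Duhamel's path: it runs from `exp y` at `r = 0` to `exp x` at `r = 1`. -/
theorem hasDerivAt_exp_smul_mul_exp_smul (x y : A) (r : ℝ) :
    HasDerivAt (fun r : ℝ => NormedSpace.exp (r • x) * NormedSpace.exp ((1 - r) • y))
      (NormedSpace.exp (r • x) * (x - y) * NormedSpace.exp ((1 - r) • y)) r := by
  have h1 := hasDerivAt_exp_smul_const (𝕂 := ℝ) x r
  have h2 : HasDerivAt (fun r : ℝ => NormedSpace.exp ((1 - r) • y))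
      (-(y * NormedSpace.exp ((1 - r) • y))) r := by
    have := (hasDerivAt_exp_smul_const' (𝕂 := ℝ) y (1 - r)).scomp r
      ((hasDerivAt_id r).const_sub 1)
    simpa [Function.comp_def] using this
  refine (h1.mul h2).congr_deriv ?_
  rw [mul_sub, sub_mul, mul_neg, ← sub_eq_add_neg, mul_assoc _ y]

/-- In the derivative of Duhamel's path the difference `x - y` stands between two unitaries, so its
norm bounds the speed. -/
theorem norm_exp_sub_exp_le {x y : A} (hx : star x = -x) (hy : star y = -y) :
    ‖NormedSpace.exp x - NormedSpace.exp y‖ ≤ ‖x - y‖ := by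
  have h := norm_image_sub_le_of_norm_deriv_le_segment_01'
    (f := fun r : ℝ => NormedSpace.exp (r • x) * NormedSpace.exp ((1 - r) • y)) (C := ‖x - y‖)
    (fun r _ => (hasDerivAt_exp_smul_mul_exp_smul x y r).hasDerivWithinAt) (fun r _ => ?_)
  · simpa [NormedSpace.exp_zero] using h
  · calc _ ≤ ‖NormedSpace.exp (r • x)‖ * ‖x - y‖ * ‖NormedSpace.exp ((1 - r) • y)‖ :=
        norm_mul₃_le
      _ ≤ 1 * ‖x - y‖ * 1 := by
        gcongr
        exacts [norm_exp_smul_le_one hx r, norm_exp_smul_le_one hy _]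
      _ = _ := by ring

/-- The first order expansion of a tracial functional of the exponential. -/
theorem norm_trace_exp_sub_le {x y : A} (hx : star x = -x) (hy : star y = -y)
    (T : A →L[ℂ] ℂ) (hT : ∀ a b, T (a * b) = T (b * a)) {K : ℝ}
    (hK : ∀ z, ‖T ((x - y) * z)‖ ≤ K * ‖z‖) :
    ‖T (NormedSpace.exp x) - T (NormedSpace.exp y) - T ((x - y) * NormedSpace.exp y)‖
      ≤ K * ‖x - y‖ := by
  let +nondep : NormedAlgebra ℚ A := .restrictScalars ℚ ℂ A
  have hK0 : 0 ≤ K * ‖x - y‖ := (norm_nonneg _).trans (hK _)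
  have hadd : ∀ r : ℝ, NormedSpace.exp y
      = NormedSpace.exp ((1 - r) • y) * NormedSpace.exp (r • y) := by
    intro r
    rw [← NormedSpace.exp_add_of_commute
      (((Commute.refl y).smul_left (1 - r)).smul_right r), ← add_smul]
    simp
  -- Subtracting the linear term from the path leaves a derivative of second order: cyclicity moves
  -- `x - y` to the front, and the remaining factor differs from `exp y` by at most `‖x - y‖`.
  have h := norm_image_sub_le_of_norm_deriv_le_segment_01'
    (f := fun r : ℝ => T (NormedSpace.exp (r • x) * NormedSpace.exp ((1 - r) • y))
      - r • T ((x - y) * NormedSpace.exp y)) (C := K * ‖x - y‖)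
    (f' := fun r : ℝ => T (NormedSpace.exp (r • x) * (x - y) * NormedSpace.exp ((1 - r) • y))
      - (1 : ℝ) • T ((x - y) * NormedSpace.exp y))
    (fun r _ => (((T.restrictScalars ℝ).hasFDerivAt.comp_hasDerivAt r
      (hasDerivAt_exp_smul_mul_exp_smul x y r)).sub
      ((hasDerivAt_id r).smul_const _)).hasDerivWithinAt) (fun r hr => ?_)
  · simpa [NormedSpace.exp_zero, sub_sub, add_comm] using h
  · have h1 : T (NormedSpace.exp (r • x) * (x - y) * NormedSpace.exp ((1 - r) • y))
        = T ((x - y) * (NormedSpace.exp ((1 - r) • y) * NormedSpace.exp (r • x))) := by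
      rw [mul_assoc, hT, mul_assoc]
    have h2 : ‖NormedSpace.exp ((1 - r) • y) *
        (NormedSpace.exp (r • x) - NormedSpace.exp (r • y))‖ ≤ 1 * ‖x - y‖ := by
      refine (norm_mul_le _ _).trans ?_
      refine mul_le_mul (norm_exp_smul_le_one hy _) ?_ (norm_nonneg _) zero_le_one
      refine (norm_exp_sub_exp_le (by rw [star_smul, hx]; simp)
        (by rw [star_smul, hy]; simp)).trans ?_
      rw [← smul_sub, norm_smul, Real.norm_of_nonneg hr.1]
      exact mul_le_of_le_one_left (norm_nonneg _) hr.2.le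
    rw [one_smul, h1, hadd r, ← map_sub, ← mul_sub, ← mul_sub]
    by_cases hK1 : 0 ≤ K
    · refine (hK _).trans ?_
      have := mul_le_mul_of_nonneg_left h2 hK1
      simpa using this
    -- A negative `K` is compatible with `hK` only if every norm vanishes.
    · have h0 : ∀ z : A, ‖z‖ = 0 := fun z => by
        have := (norm_nonneg _).trans (hK z)
        have := norm_nonneg z
        nlinarith
      refine (hK _).trans ?_
      rw [h0, h0]

end SkewAdjoint

/-! ### Perturbing one entry of a symmetric matrix -/

section Perturbation

open scoped Matrix.Norms.L2Operator

variable {n : ℕ}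

/-- The positions on and above the diagonal. -/
abbrev UpperIndex (n : ℕ) : Type := {p : Fin n × Fin n // p.1 ≤ p.2}

/-- The position on or above the diagonal that determines the entry `(j, k)` of a symmetric
matrix. -/
def upperIndex (j k : Fin n) : UpperIndex n := ⟨(min j k, max j k), min_le_max⟩

/-- The symmetric matrix with the given entries on and above the diagonal. -/
def symmMatrix (x : UpperIndex n → ℝ) : Matrix (Fin n) (Fin n) ℝ :=
  Matrix.of fun j k => x (upperIndex j k)

theorem symmMatrix_isSymm (x : UpperIndex n → ℝ) : (symmMatrix x).IsSymm := by
  ext j k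
  simp [symmMatrix, upperIndex, min_comm, max_comm]

/-- The symmetric matrix with ones in the position `p` and in its mirror image, and zeros
elsewhere. -/
def symmUnit (p : UpperIndex n) : Matrix (Fin n) (Fin n) ℂ :=
  Matrix.single p.1.1 p.1.2 1 + if p.1.1 = p.1.2 then 0 else Matrix.single p.1.2 p.1.1 1

theorem symmUnit_apply (p : UpperIndex n) (j k : Fin n) :
    symmUnit p j k = if upperIndex j k = p then 1 else 0 := by
  obtain ⟨⟨a, b⟩, hab⟩ := p
  simp only [symmUnit, upperIndex, Subtype.mk.injEq, Prod.mk.injEq, Matrix.add_apply,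
    Matrix.single_apply]
  simp only at hab
  split_ifs with h1 h2 h3 h4 h5 h6 <;> simp_all [Matrix.single_apply] <;> grind

/-- By the C*-identity the norm is read off a diagonal matrix. -/
theorem norm_single (i j : Fin n) (z : ℂ) :
    ‖(Matrix.single i j z : Matrix (Fin n) (Fin n) ℂ)‖ = ‖z‖ := by
  have h := Matrix.l2_opNorm_conjTranspose_mul_self (Matrix.single i j z : Matrix (Fin n) (Fin n) ℂ)
  rw [Matrix.conjTranspose_single, Matrix.single_mul_single_same, ← Matrix.diagonal_single,
    Matrix.l2_opNorm_diagonal, Pi.norm_single, norm_mul, norm_star] at h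
  exact ((mul_self_inj (norm_nonneg _) (norm_nonneg _)).1 h).symm

theorem norm_entry_le (Z : Matrix (Fin n) (Fin n) ℂ) (i j : Fin n) : ‖Z i j‖ ≤ ‖Z‖ := by
  have h : Matrix.single i i 1 * Z * Matrix.single j j 1 = Matrix.single i j (Z i j) := by
    rw [Matrix.single_mul_mul_single]; simp
  rw [← norm_single i j (Z i j), ← h]
  refine norm_mul₃_le.trans ?_
  simp [norm_single]

theorem norm_symmUnit_le (p : UpperIndex n) : ‖symmUnit p‖ ≤ 2 := by
  refine (norm_add_le _ _).trans ?_
  split_ifs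
  · simp [norm_single]
  · simp only [norm_single, norm_one]; norm_num

theorem trace_symmUnit_mul (p : UpperIndex n) (Z : Matrix (Fin n) (Fin n) ℂ) :
    (symmUnit p * Z).trace = Z p.1.2 p.1.1 + if p.1.1 = p.1.2 then 0 else Z p.1.1 p.1.2 := by
  rw [symmUnit, add_mul, Matrix.trace_add]
  split_ifs <;> simp [Matrix.trace_single_mul]

theorem norm_trace_symmUnit_mul_le (p : UpperIndex n) (Z : Matrix (Fin n) (Fin n) ℂ) :
    ‖(symmUnit p * Z).trace‖ ≤ 2 * ‖Z‖ := by
  rw [trace_symmUnit_mul]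
  refine (norm_add_le _ _).trans ?_
  have h1 := norm_entry_le Z p.1.2 p.1.1
  have h2 := norm_entry_le Z p.1.1 p.1.2
  split_ifs
  · rw [norm_zero]; linarith [norm_nonneg Z]
  · linarith

theorem norm_trace_symmUnit_mul_sq_le (p : UpperIndex n) (Z : Matrix (Fin n) (Fin n) ℂ) :
    ‖(symmUnit p * Z).trace‖ ^ 2 ≤ 2 * (‖Z p.1.2 p.1.1‖ ^ 2 + ‖Z p.1.1 p.1.2‖ ^ 2) := by
  rw [trace_symmUnit_mul]
  have h : ‖Z p.1.2 p.1.1 + if p.1.1 = p.1.2 then 0 else Z p.1.1 p.1.2‖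
      ≤ ‖Z p.1.2 p.1.1‖ + ‖Z p.1.1 p.1.2‖ := by
    refine (norm_add_le _ _).trans (add_le_add le_rfl ?_)
    split_ifs <;> simp
  refine (pow_le_pow_left₀ (norm_nonneg _) h 2).trans ?_
  nlinarith [sq_nonneg (‖Z p.1.2 p.1.1‖ - ‖Z p.1.1 p.1.2‖)]

theorem sum_norm_entry_sq_of_mem_unitary {U : Matrix (Fin n) (Fin n) ℂ} (hU : U ∈ unitary _) :
    ∑ j, ∑ k, ‖U j k‖ ^ 2 = n := by
  have h : ∀ j, ∑ k, ‖U j k‖ ^ 2 = (1 : ℝ) := fun j => by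
    have h1 : (U * star U) j j = 1 := by rw [Unitary.mul_star_self_of_mem hU, Matrix.one_apply_eq]
    rw [Matrix.mul_apply] at h1
    simp only [Matrix.star_apply, RCLike.star_def, Complex.mul_conj,
      Complex.normSq_eq_norm_sq] at h1
    exact_mod_cast h1
  simp [h]

/-- The bound `2` on each trace would only give order `n²`. Unitarity makes the squared entries sum
to `n`, and this gain balances the variance `O(1/n)` of the entries. -/
theorem sum_norm_trace_symmUnit_mul_sq_le {U : Matrix (Fin n) (Fin n) ℂ} (hU : U ∈ unitary _) :
    ∑ p, ‖(symmUnit p * U).trace‖ ^ 2 ≤ 4 * n := by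
  calc ∑ p, ‖(symmUnit p * U).trace‖ ^ 2
      ≤ ∑ p : UpperIndex n, 2 * (‖U p.1.2 p.1.1‖ ^ 2 + ‖U p.1.1 p.1.2‖ ^ 2) :=
        Finset.sum_le_sum fun p _ => norm_trace_symmUnit_mul_sq_le p U
    _ = ∑ q : Fin n × Fin n with q.1 ≤ q.2, 2 * (‖U q.2 q.1‖ ^ 2 + ‖U q.1 q.2‖ ^ 2) :=
        (Finset.sum_subtype _ (by simp)
          (fun q : Fin n × Fin n => 2 * (‖U q.2 q.1‖ ^ 2 + ‖U q.1 q.2‖ ^ 2))).symm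
    _ ≤ ∑ q : Fin n × Fin n, 2 * (‖U q.2 q.1‖ ^ 2 + ‖U q.1 q.2‖ ^ 2) :=
        Finset.sum_le_univ_sum_of_nonneg fun q => by positivity
    _ = 4 * n := by
        rw [← Finset.mul_sum, Finset.sum_add_distrib, Fintype.sum_prod_type_right,
          Fintype.sum_prod_type]
        simp only [sum_norm_entry_sq_of_mem_unitary hU]
        ring

/-- The exponential `exp(i t A)` of a real matrix `A`. -/
noncomputable def expI (t : ℝ) (A : Matrix (Fin n) (Fin n) ℝ) : Matrix (Fin n) (Fin n) ℂ :=
  NormedSpace.exp ((Complex.I * (t : ℂ)) • A.map (fun x : ℝ => (x : ℂ)))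

theorem star_I_smul_map {A : Matrix (Fin n) (Fin n) ℝ} (hA : A.IsSymm) (t : ℝ) :
    star ((Complex.I * (t : ℂ)) • A.map (fun x : ℝ => (x : ℂ)))
      = -((Complex.I * (t : ℂ)) • A.map (fun x : ℝ => (x : ℂ))) := by
  ext j k
  simp [hA.apply j k]

theorem expI_mem_unitary {A : Matrix (Fin n) (Fin n) ℝ} (hA : A.IsSymm) (t : ℝ) :
    expI t A ∈ unitary (Matrix (Fin n) (Fin n) ℂ) :=
  exp_mem_unitary_of_star_eq_neg (star_I_smul_map hA t)

theorem norm_traceExp_le {A : Matrix (Fin n) (Fin n) ℝ} (hA : A.IsSymm) (t : ℝ) :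
    ‖traceExp A t‖ ≤ n := by
  have h : ∀ j, ‖expI t A j j‖ ≤ 1 := fun j =>
    (norm_entry_le _ j j).trans (norm_le_one_of_mem_unitary (expI_mem_unitary hA t))
  calc ‖traceExp A t‖ = ‖∑ j, expI t A j j‖ := rfl
    _ ≤ ∑ j : Fin n, ‖expI t A j j‖ := norm_sum_le _ _
    _ ≤ ∑ j : Fin n, (1 : ℝ) := Finset.sum_le_sum fun j _ => h j
    _ = n := by simp

theorem continuous_expI : Continuous fun z : ℝ × Matrix (Fin n) (Fin n) ℝ => expI z.1 z.2 := by
  let +nondep : NormedAlgebra ℚ (Matrix (Fin n) (Fin n) ℂ) := .restrictScalars ℚ ℂ _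
  refine NormedSpace.exp_continuous.comp ?_
  have h1 : Continuous fun z : ℝ × Matrix (Fin n) (Fin n) ℝ => Complex.I * (z.1 : ℂ) := by fun_prop
  exact h1.smul (continuous_snd.matrix_map Complex.continuous_ofReal)

theorem continuous_traceExp :
    Continuous fun z : Matrix (Fin n) (Fin n) ℝ × ℝ => traceExp z.1 z.2 :=
  (continuous_expI.comp continuous_swap).matrix_trace

theorem continuous_symmMatrix : Continuous (symmMatrix : (UpperIndex n → ℝ) → _) :=
  continuous_matrix fun _ _ => continuous_apply _

theorem I_smul_symmMatrix_sub_update (t : ℝ) (x : UpperIndex n → ℝ) (p : UpperIndex n) :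
    (Complex.I * (t : ℂ)) • (symmMatrix x).map (fun x : ℝ => (x : ℂ))
      - (Complex.I * (t : ℂ)) • (symmMatrix (Function.update x p 0)).map (fun x : ℝ => (x : ℂ))
      = (Complex.I * (t : ℂ) * x p) • symmUnit p := by
  ext j k
  simp only [Matrix.sub_apply, Matrix.smul_apply, Matrix.map_apply, symmMatrix, Matrix.of_apply,
    symmUnit_apply, smul_eq_mul]
  by_cases h : upperIndex j k = p
  · simp [h]
  · simp [h, Function.update_of_ne]

theorem norm_expI_sub_update_le (t : ℝ) (x : UpperIndex n → ℝ) (p : UpperIndex n) :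
    ‖expI t (symmMatrix x) - expI t (symmMatrix (Function.update x p 0))‖
      ≤ 2 * (|t| * |x p|) := by
  refine (norm_exp_sub_exp_le (star_I_smul_map (symmMatrix_isSymm _) t)
    (star_I_smul_map (symmMatrix_isSymm _) t)).trans ?_
  rw [I_smul_symmMatrix_sub_update, norm_smul]
  have := norm_symmUnit_le p
  simp only [norm_mul, Complex.norm_I, one_mul, Complex.norm_real, Real.norm_eq_abs]
  nlinarith [mul_nonneg (abs_nonneg t) (abs_nonneg (x p))]

/-- The expansion is made around the matrix with `x p` removed, so that the first-order coefficient
does not involve `x p`. The constant `4` is the trace bound `2` times `‖symmUnit p‖ ≤ 2`. -/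
theorem norm_traceExp_sub_update_le (t : ℝ) (x : UpperIndex n → ℝ) (p : UpperIndex n) :
    ‖traceExp (symmMatrix x) t - traceExp (symmMatrix (Function.update x p 0)) t‖
      ≤ |t| * |x p| * ‖(symmUnit p * expI t (symmMatrix (Function.update x p 0))).trace‖
        + 4 * (|t| * |x p|) ^ 2 := by
  have hn : ‖Complex.I * (t : ℂ) * x p‖ = |t| * |x p| := by simp
  have h := norm_trace_exp_sub_le (star_I_smul_map (symmMatrix_isSymm x) t)
    (star_I_smul_map (symmMatrix_isSymm (Function.update x p 0)) t)
    (LinearMap.toContinuousLinearMap (Matrix.traceLinearMap (Fin n) ℂ ℂ))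
    (fun a b => Matrix.trace_mul_comm a b) (K := 2 * (|t| * |x p|)) (fun z => by
      rw [I_smul_symmMatrix_sub_update]
      simp only [LinearMap.coe_toContinuousLinearMap', Matrix.traceLinearMap_apply, smul_mul_assoc,
        Matrix.trace_smul, norm_smul, hn]
      have := norm_trace_symmUnit_mul_le p z
      have h0 : 0 ≤ |t| * |x p| := by positivity
      nlinarith)
  rw [I_smul_symmMatrix_sub_update] at h
  simp only [LinearMap.coe_toContinuousLinearMap', Matrix.traceLinearMap_apply, smul_mul_assoc,
    Matrix.trace_smul, norm_smul, hn] at h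
  have h' : ‖traceExp (symmMatrix x) t - traceExp (symmMatrix (Function.update x p 0)) t
      - (Complex.I * (t : ℂ) * x p) •
        (symmUnit p * expI t (symmMatrix (Function.update x p 0))).trace‖
      ≤ 2 * (|t| * |x p|) * (|t| * |x p| * ‖symmUnit p‖) := h
  have h2 := norm_le_norm_add_norm_sub'
    (traceExp (symmMatrix x) t - traceExp (symmMatrix (Function.update x p 0)) t)
    ((Complex.I * (t : ℂ) * x p) •
        (symmUnit p * expI t (symmMatrix (Function.update x p 0))).trace)
  rw [norm_smul, hn] at h2
  refine h2.trans (add_le_add le_rfl (h'.trans ?_))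
  have := norm_symmUnit_le p
  have h0 : 0 ≤ (|t| * |x p|) ^ 2 := by positivity
  nlinarith

theorem norm_traceExp_sub_update_sq_le (t : ℝ) (x : UpperIndex n → ℝ) (p : UpperIndex n) :
    ‖traceExp (symmMatrix x) t - traceExp (symmMatrix (Function.update x p 0)) t‖ ^ 2
      ≤ 2 * t ^ 2 * (x p ^ 2 *
          ‖(symmUnit p * expI t (symmMatrix (Function.update x p 0))).trace‖ ^ 2)
        + 32 * t ^ 4 * x p ^ 4 := by
  refine (pow_le_pow_left₀ (norm_nonneg _) (norm_traceExp_sub_update_le t x p) 2).trans ?_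
  refine add_sq_le.trans_eq ?_
  have h4 : ∀ a : ℝ, |a| ^ 4 = a ^ 4 := fun a => Even.pow_abs (by decide) a
  ring_nf
  simp only [sq_abs, h4]
  ring

/-- This returns to a unitary that is the same for all `p`, as the sum over `p` requires. -/
theorem norm_trace_symmUnit_mul_update_sq_le (t : ℝ) (x : UpperIndex n → ℝ) (p : UpperIndex n) :
    ‖(symmUnit p * expI t (symmMatrix (Function.update x p 0))).trace‖ ^ 2
      ≤ 2 * ‖(symmUnit p * expI t (symmMatrix x)).trace‖ ^ 2 + 32 * t ^ 2 * x p ^ 2 := by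
  set a := (symmUnit p * expI t (symmMatrix (Function.update x p 0))).trace
  set b := (symmUnit p * expI t (symmMatrix x)).trace
  have h : ‖b - a‖ ≤ 4 * (|t| * |x p|) := by
    rw [← Matrix.trace_sub, ← mul_sub]
    have h1 := norm_trace_symmUnit_mul_le p
      (expI t (symmMatrix x) - expI t (symmMatrix (Function.update x p 0)))
    have h2 := norm_expI_sub_update_le t x p
    linarith
  have h2 : ‖a‖ ≤ ‖b‖ + 4 * (|t| * |x p|) :=
    (norm_le_norm_add_norm_sub b a).trans (add_le_add le_rfl h)
  refine (pow_le_pow_left₀ (norm_nonneg _) h2 2).trans (add_sq_le.trans_eq ?_)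
  rw [mul_pow, mul_pow, sq_abs, sq_abs]
  ring

end Perturbation

/-! ### The variance of the trace of the exponential -/

section Variance

open scoped Matrix.Norms.L2Operator

theorem measurable_update_zero {ι : Type*} [DecidableEq ι] (i : ι) :
    Measurable fun x : ι → ℝ => Function.update x i 0 :=
  measurable_update_left

/-- After the update, `G` sees only the coordinates other than `i`, which are jointly independent of
`X i`. -/
theorem integral_sq_mul_update_eq {Ω ι : Type*} [MeasurableSpace Ω] [Fintype ι] [DecidableEq ι]
    (P : Measure Ω) {X : ι → Ω → ℝ} (hX : ∀ i, Measurable (X i)) (hind : iIndepFun X P)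
    {G : (ι → ℝ) → ℝ} (hG : Measurable G) (i : ι) :
    ∫ ω, X i ω ^ 2 * G (Function.update (fun j => X j ω) i 0) ∂P
      = (∫ ω, X i ω ^ 2 ∂P) * ∫ ω, G (Function.update (fun j => X j ω) i 0) ∂P := by
  have h := hind.indepFun_finset {i} {i}ᶜ disjoint_compl_right hX
  have hφ : Measurable fun y : (({i} : Finset ι) → ℝ) => y ⟨i, by simp⟩ ^ 2 :=
    (measurable_pi_apply _).pow_const 2
  have hψ : Measurable fun (y : (({i}ᶜ : Finset ι) → ℝ)) (j : ι) =>
      if hj : j = i then (0 : ℝ) else y ⟨j, by simpa using hj⟩ := by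
    refine measurable_pi_lambda _ fun j => ?_
    by_cases hj : j = i
    · simp [hj]
    · simpa [hj] using measurable_pi_apply _
  have heq : ∀ ω, Function.update (fun j => X j ω) i 0
      = fun j => if hj : j = i then (0 : ℝ) else X j ω := by
    intro ω
    ext j
    by_cases hj : j = i
    · subst hj; simp
    · simp [hj]
  have h2 := h.comp hφ (hG.comp hψ)
  have hXm : AEStronglyMeasurable (fun ω => X i ω ^ 2) P :=
    ((hX i).pow_const 2).aestronglyMeasurable
  have hup : Measurable fun ω => Function.update (fun j => X j ω) i 0 :=
    (measurable_update_zero i).comp (measurable_pi_lambda _ hX)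
  refine IndepFun.integral_fun_mul_eq_mul_integral ?_ hXm
    (hG.comp hup).aestronglyMeasurable
  simp only [heq]
  exact h2

variable {n : ℕ}

theorem card_upperIndex_le : (Fintype.card (UpperIndex n) : ℝ) ≤ (n : ℝ) ^ 2 := by
  have h := Fintype.card_subtype_le fun p : Fin n × Fin n => p.1 ≤ p.2
  rw [Fintype.card_prod, Fintype.card_fin] at h
  rw [sq]
  exact_mod_cast h

theorem measurable_traceExp_symmMatrix (t : ℝ) :
    Measurable fun x : UpperIndex n → ℝ => traceExp (symmMatrix x) t :=
  (continuous_traceExp.comp (continuous_symmMatrix.prodMk continuous_const)).measurable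

theorem measurable_trace_symmUnit_mul_expI (t : ℝ) (p : UpperIndex n) :
    Measurable fun x : UpperIndex n → ℝ => (symmUnit p * expI t (symmMatrix x)).trace :=
  ((continuous_const.mul (continuous_expI.comp
    (continuous_const.prodMk continuous_symmMatrix))).matrix_trace).measurable

/-- The variance of `Tr exp(i t A)` for a symmetric matrix `A` with independent entries. -/
theorem complexVar_traceExp_symmMatrix_le {Ω : Type*} [MeasurableSpace Ω] (P : Measure Ω)
    [IsProbabilityMeasure P] {X : UpperIndex n → Ω → ℝ} (hX : ∀ p, Measurable (X p))
    (hind : iIndepFun X P) {a b : ℝ} (h2i : ∀ p, Integrable (fun ω => X p ω ^ 2) P)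
    (h4i : ∀ p, Integrable (fun ω => X p ω ^ 4) P)
    (h2 : ∀ p, ∫ ω, X p ω ^ 2 ∂P ≤ a) (h4 : ∀ p, ∫ ω, X p ω ^ 4 ∂P ≤ b) (ha : 0 ≤ a)
    (hb : 0 ≤ b) (t : ℝ) :
    complexVar (fun ω => traceExp (symmMatrix fun p => X p ω) t) P
      ≤ 16 * t ^ 2 * a * n + n ^ 2 * (64 * t ^ 4 * a ^ 2 + 32 * t ^ 4 * b) := by
  set e : UpperIndex n → (UpperIndex n → ℝ) → ℂ :=
    fun p x => (symmUnit p * expI t (symmMatrix x)).trace with he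
  have hem : ∀ p, Measurable (e p) := measurable_trace_symmUnit_mul_expI t
  have heb : ∀ p x, ‖e p x‖ ≤ 2 := fun p x => by
    refine (norm_trace_symmUnit_mul_le p _).trans ?_
    have := norm_le_one_of_mem_unitary (expI_mem_unitary (symmMatrix_isSymm x) t)
    linarith
  have hXm : Measurable fun ω p => X p ω := measurable_pi_lambda _ hX
  have hup : ∀ p, Measurable fun ω => Function.update (fun q => X q ω) p 0 := fun p =>
    (measurable_update_zero p).comp hXm
  have hei : ∀ p, Integrable (fun ω => ‖e p fun q => X q ω‖ ^ 2) P := fun p =>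
    integrable_norm_sq_of_norm_le P ((hem p).comp hXm) fun ω => heb p _
  have hei0 : ∀ p, Integrable (fun ω => ‖e p (Function.update (fun q => X q ω) p 0)‖ ^ 2) P :=
    fun p => integrable_norm_sq_of_norm_le P ((hem p).comp (hup p)) fun ω => heb p _
  have hu := measurable_traceExp_symmMatrix (n := n) t
  refine (efronStein P hX hind hu fun x => norm_traceExp_le (symmMatrix_isSymm x) t).trans ?_
  have hterm : ∀ p, ∫ ω, ‖traceExp (symmMatrix fun q => X q ω) t
      - traceExp (symmMatrix (Function.update (fun q => X q ω) p 0)) t‖ ^ 2 ∂P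
      ≤ 2 * t ^ 2 * a * (2 * ∫ ω, ‖e p fun q => X q ω‖ ^ 2 ∂P)
        + (64 * t ^ 4 * a ^ 2 + 32 * t ^ 4 * b) := by
    intro p
    have hprod : Integrable (fun ω => X p ω ^ 2 *
        ‖e p (Function.update (fun q => X q ω) p 0)‖ ^ 2) P := by
      refine (h2i p).mul_bdd (c := 4) (hei0 p).aestronglyMeasurable (ae_of_all _ fun ω => ?_)
      rw [norm_pow, norm_norm]
      nlinarith [heb p (Function.update (fun q => X q ω) p 0),
        norm_nonneg (e p (Function.update (fun q => X q ω) p 0))]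
    have h1 : ∫ ω, ‖traceExp (symmMatrix fun q => X q ω) t
        - traceExp (symmMatrix (Function.update (fun q => X q ω) p 0)) t‖ ^ 2 ∂P
        ≤ 2 * t ^ 2 * ((∫ ω, X p ω ^ 2 ∂P) *
            ∫ ω, ‖e p (Function.update (fun q => X q ω) p 0)‖ ^ 2 ∂P)
          + 32 * t ^ 4 * ∫ ω, X p ω ^ 4 ∂P := by
      rw [← integral_sq_mul_update_eq P hX hind (G := fun x => ‖e p x‖ ^ 2)
        ((hem p).norm.pow_const 2), ← integral_const_mul, ← integral_const_mul,
        ← integral_add (hprod.const_mul _) ((h4i p).const_mul _)]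
      refine integral_mono (integrable_norm_sq_of_norm_le P ((hu.comp hXm).sub
        (hu.comp (hup p))) fun ω => (norm_sub_le _ _).trans (add_le_add
          (norm_traceExp_le (symmMatrix_isSymm _) t) (norm_traceExp_le (symmMatrix_isSymm _) t)))
        ((hprod.const_mul _).add ((h4i p).const_mul _)) fun ω => ?_
      exact norm_traceExp_sub_update_sq_le t _ p
    -- Only after independence has been used may the removed entry be restored; the cost becomes the
    -- term `64 t⁴ a²`.
    have h3 : ∫ ω, ‖e p (Function.update (fun q => X q ω) p 0)‖ ^ 2 ∂P
        ≤ 2 * ∫ ω, ‖e p fun q => X q ω‖ ^ 2 ∂P + 32 * t ^ 2 * a := by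
      calc _ ≤ ∫ ω, (2 * ‖e p fun q => X q ω‖ ^ 2 + 32 * t ^ 2 * X p ω ^ 2) ∂P :=
            integral_mono (hei0 p) (((hei p).const_mul _).add ((h2i p).const_mul _)) fun ω =>
              norm_trace_symmUnit_mul_update_sq_le t _ p
        _ = 2 * ∫ ω, ‖e p fun q => X q ω‖ ^ 2 ∂P + 32 * t ^ 2 * ∫ ω, X p ω ^ 2 ∂P := by
            rw [integral_add ((hei p).const_mul _) ((h2i p).const_mul _), integral_const_mul,
              integral_const_mul]
        _ ≤ _ := by gcongr; exact h2 p
    have h0 : 0 ≤ ∫ ω, ‖e p (Function.update (fun q => X q ω) p 0)‖ ^ 2 ∂P :=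
      integral_nonneg fun _ => by positivity
    calc _ ≤ _ := h1
      _ ≤ 2 * t ^ 2 * (a * (2 * ∫ ω, ‖e p fun q => X q ω‖ ^ 2 ∂P + 32 * t ^ 2 * a))
          + 32 * t ^ 4 * b := by
        gcongr
        exacts [h2 p, h4 p]
      _ = _ := by ring
  refine (Finset.sum_le_sum fun p _ => hterm p).trans ?_
  rw [Finset.sum_add_distrib, ← Finset.mul_sum, ← Finset.mul_sum, Finset.sum_const,
    Finset.card_univ, nsmul_eq_mul, ← integral_finsetSum _ fun p _ => hei p]
  -- The unitarity bound holds for every outcome, hence in mean.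
  have hsum : ∫ ω, ∑ p, ‖e p fun q => X q ω‖ ^ 2 ∂P ≤ 4 * n := by
    calc _ ≤ ∫ _ : Ω, (4 * n : ℝ) ∂P := integral_mono (integrable_finsetSum _ fun p _ => hei p)
          (integrable_const _) fun ω =>
            sum_norm_trace_symmUnit_mul_sq_le (expI_mem_unitary (symmMatrix_isSymm _) t)
      _ = _ := by simp
  calc _ ≤ 2 * t ^ 2 * a * (2 * (4 * n)) + n ^ 2 * (64 * t ^ 4 * a ^ 2 + 32 * t ^ 4 * b) := by
        gcongr
        exact card_upperIndex_le
    _ = _ := by ring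

end Variance

/-! ### Truncated Wigner matrices -/

section Truncation

theorem abs_sign_mul_min_le {x c : ℝ} (hc : 0 ≤ c) : |Real.sign x * min |x| c| ≤ |x| := by
  rw [abs_mul, abs_of_nonneg (le_min (abs_nonneg x) hc)]
  have h : |Real.sign x| ≤ 1 := by
    rcases Real.sign_apply_eq x with h | h | h <;> simp [h]
  calc _ ≤ 1 * |x| := by gcongr; exact min_le_left _ _
    _ = _ := one_mul _

variable {n : ℕ}

theorem abs_truncatedMatrix_le {τ : ℝ} (hτ : 0 ≤ τ) (W : Matrix (Fin n) (Fin n) ℝ)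
    (j k : Fin n) : |truncatedMatrix τ W j k| ≤ |(√(n : ℝ))⁻¹ * W j k| := by
  simp only [truncatedMatrix, Matrix.of_apply]
  rw [abs_mul, abs_mul _ (W j k)]
  exact mul_le_mul_of_nonneg_left (abs_sign_mul_min_le (by positivity)) (abs_nonneg _)

theorem truncatedMatrix_sq_le {τ : ℝ} (hτ : 0 ≤ τ) (W : Matrix (Fin n) (Fin n) ℝ)
    (j k : Fin n) : truncatedMatrix τ W j k ^ 2 ≤ W j k ^ 2 / n := by
  refine (sq_le_sq.2 (abs_truncatedMatrix_le hτ W j k)).trans_eq ?_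
  rw [mul_pow, inv_pow, Real.sq_sqrt (Nat.cast_nonneg n)]
  ring

theorem truncatedMatrix_pow_four_le {τ : ℝ} (hτ : 0 ≤ τ) (W : Matrix (Fin n) (Fin n) ℝ)
    (j k : Fin n) : truncatedMatrix τ W j k ^ 4 ≤ W j k ^ 4 / n ^ 2 := by
  have h := pow_le_pow_left₀ (sq_nonneg _) (truncatedMatrix_sq_le hτ W j k) 2
  rw [div_pow, ← pow_mul, ← pow_mul] at h
  exact h

theorem measurable_real_sign : Measurable Real.sign := by
  unfold Real.sign
  exact Measurable.ite measurableSet_Iio measurable_const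
    (Measurable.ite measurableSet_Ioi measurable_const measurable_const)

theorem measurable_truncation (c d : ℝ) :
    Measurable fun x : ℝ => c * (Real.sign x * min |x| d) :=
  (measurable_real_sign.mul (measurable_id.abs.min measurable_const)).const_mul c

/-- This exhibits the truncated matrix as a function of its independent entries. -/
theorem truncatedMatrix_eq_symmMatrix (τ : ℝ) {W : Matrix (Fin n) (Fin n) ℝ} (hW : W.IsSymm) :
    truncatedMatrix τ W = symmMatrix fun p => truncatedMatrix τ W p.1.1 p.1.2 := by
  ext j k
  have hs : (truncatedMatrix τ W).IsSymm := by
    ext j k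
    simp [truncatedMatrix, hW.apply j k]
  rcases le_total j k with h | h
  · simp [symmMatrix, upperIndex, h]
  · simp [symmMatrix, upperIndex, h, hs.apply j k]

theorem truncatedMatrix_isSymm (τ : ℝ) {W : Matrix (Fin n) (Fin n) ℝ} (hW : W.IsSymm) :
    (truncatedMatrix τ W).IsSymm := by
  rw [truncatedMatrix_eq_symmMatrix τ hW]
  exact symmMatrix_isSymm _

end Truncation

/-! ### Moments of the truncated entries and the resulting variance bound -/

section Wigner

variable {Ω : ℕ → Type*} [∀ n, MeasurableSpace (Ω n)] {P : ∀ n, Measure (Ω n)}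
  {W : ∀ n, Ω n → Matrix (Fin n) (Fin n) ℝ} {w μ₃ μ₄ : ℝ}

theorem HasMoments.integrable_pow_four (hM : HasMoments P W μ₃ μ₄) (n : ℕ) (j k : Fin n) :
    Integrable (fun ω => W n ω j k ^ 4) (P n) := by
  have h := (hM.fourth_integrable n j k).integrable_norm_pow (p := 4) (by norm_num)
  refine h.congr (ae_of_all _ fun ω => ?_)
  exact Even.pow_abs (by decide) _

/-- A diagonal entry has second moment `2 w²`, whose square is at most the fourth moment. This lets
the final constant depend on `μ₄` and not on `w`. -/
theorem IsWigner.four_mul_pow_four_le [∀ n, IsProbabilityMeasure (P n)]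
    (hW : IsWigner P w W) (hM : HasMoments P W μ₃ μ₄) {n : ℕ}
    (hn : 0 < n) : 4 * w ^ 4 ≤ μ₄ := by
  set j : Fin n := ⟨0, hn⟩
  have h2 : Integrable (fun ω => W n ω j j ^ 2) (P n) := (hW.sq_integrable n j j).integrable_sq
  have h4 := hM.integrable_pow_four n j j
  have e2 := hW.second_moment n j j
  simp only [if_true] at e2
  have e4 := hM.fourth n j j
  have h : 0 ≤ ∫ ω, (W n ω j j ^ 2 - 2 * w ^ 2) ^ 2 ∂(P n) :=
    integral_nonneg fun _ => sq_nonneg _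
  have hpt : ∀ ω, (W n ω j j ^ 2 - 2 * w ^ 2) ^ 2
      = W n ω j j ^ 4 - 4 * w ^ 2 * W n ω j j ^ 2 + 4 * w ^ 4 := fun ω => by ring
  simp_rw [hpt] at h
  rw [integral_add (f := fun ω => W n ω j j ^ 4 - 4 * w ^ 2 * W n ω j j ^ 2)
    (h4.sub (h2.const_mul _)) (integrable_const _), integral_sub h4 (h2.const_mul _),
    integral_const_mul, e2, e4] at h
  simp only [integral_const, probReal_univ, smul_eq_mul] at h
  nlinarith

theorem IsWigner.measurable_truncatedMatrix (hW : IsWigner P w W) (τ : ℝ) (n : ℕ) (j k : Fin n) :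
    Measurable fun ω => truncatedMatrix τ (W n ω) j k :=
  (measurable_truncation _ _).comp (hW.measurable_entry n j k)

/-- The variance of the trace of the exponential of a truncated Wigner matrix. -/
theorem IsWigner.complexVar_traceExp_le [∀ n, IsProbabilityMeasure (P n)]
    (hW : IsWigner P w W) (hM : HasMoments P W μ₃ μ₄) {τ : ℝ}
    (hτ : 0 < τ) (n : ℕ) (t : ℝ) :
    complexVar (fun ω => traceExp (truncatedMatrix τ (W n ω)) t) (P n)
      ≤ 128 * (1 + |μ₄|) * (1 + |t| ^ 4) ^ 2 := by
  have hm := fun p : UpperIndex n => hW.measurable_truncatedMatrix τ n p.1.1 p.1.2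
  have hind : iIndepFun (fun (p : UpperIndex n) ω => truncatedMatrix τ (W n ω) p.1.1 p.1.2) (P n) :=
    (hW.indep n).comp (fun _ x => (√(n : ℝ))⁻¹ * (Real.sign x * min |x| (τ * √(n : ℝ))))
      fun _ => measurable_truncation _ _
  have h2i : ∀ p : UpperIndex n, Integrable (fun ω => W n ω p.1.1 p.1.2 ^ 2 / n) (P n) := fun p =>
    (hW.sq_integrable n _ _).integrable_sq.div_const _
  have h4i : ∀ p : UpperIndex n, Integrable (fun ω => W n ω p.1.1 p.1.2 ^ 4 / (n : ℝ) ^ 2) (P n) :=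
    fun p => (hM.integrable_pow_four n _ _).div_const _
  have h2t : ∀ p : UpperIndex n,
      Integrable (fun ω => truncatedMatrix τ (W n ω) p.1.1 p.1.2 ^ 2) (P n) := fun p =>
    (h2i p).mono' ((hm p).pow_const 2).aestronglyMeasurable (ae_of_all _ fun ω => by
      rw [Real.norm_of_nonneg (by positivity)]
      exact truncatedMatrix_sq_le hτ.le _ _ _)
  have h4t : ∀ p : UpperIndex n,
      Integrable (fun ω => truncatedMatrix τ (W n ω) p.1.1 p.1.2 ^ 4) (P n) := fun p =>
    (h4i p).mono' ((hm p).pow_const 4).aestronglyMeasurable (ae_of_all _ fun ω => by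
      rw [Real.norm_of_nonneg (by positivity)]
      exact truncatedMatrix_pow_four_le hτ.le _ _ _)
  have ht : |t| ^ 4 = t ^ 4 := Even.pow_abs (by decide) t
  -- The factor `2` in `a` covers the larger variance on the diagonal.
  have h := complexVar_traceExp_symmMatrix_le (P n) hm hind (a := 2 * w ^ 2 / n)
    (b := |μ₄| / n ^ 2) h2t h4t (fun p => ?_) (fun p => ?_) (by positivity) (by positivity) t
  · simp_rw [← truncatedMatrix_eq_symmMatrix τ (hW.symm n _)] at h
    refine h.trans ?_
    rcases Nat.eq_zero_or_pos n with rfl | hn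
    · simp only [Nat.cast_zero, mul_zero, ne_eq, OfNat.ofNat_ne_zero, not_false_eq_true, zero_pow,
        zero_mul, add_zero]
      positivity
    · have hn' : (n : ℝ) ≠ 0 := by positivity
      have hw := hW.four_mul_pow_four_le hM hn
      have h4 : |μ₄| = μ₄ := abs_of_nonneg (by nlinarith [sq_nonneg (w ^ 2)])
      have hs : 16 * t ^ 2 * (2 * w ^ 2 / n) * n
          + n ^ 2 * (64 * t ^ 4 * (2 * w ^ 2 / n) ^ 2 + 32 * t ^ 4 * (|μ₄| / n ^ 2))
          = 32 * (t ^ 2 * w ^ 2) + t ^ 4 * (256 * w ^ 4 + 32 * μ₄) := by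
        rw [h4]; field_simp; ring
      rw [hs, h4, ht]
      have hw2 : w ^ 2 ≤ 1 + μ₄ := by nlinarith [sq_nonneg (w ^ 2 - 1), sq_nonneg (w ^ 2)]
      have ht2 : t ^ 2 ≤ (1 + t ^ 4) ^ 2 := by
        nlinarith [sq_nonneg (t ^ 2 - 1), sq_nonneg (t ^ 2), sq_nonneg (t ^ 4)]
      have ht4 : t ^ 4 ≤ (1 + t ^ 4) ^ 2 := by
        nlinarith [sq_nonneg (t ^ 2), sq_nonneg (t ^ 4)]
      -- From `4 w⁴ ≤ μ₄` one has `256 w⁴ + 32 μ₄ ≤ 96 μ₄`; then `128 = 32 + 96`.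
      calc _ ≤ 32 * ((1 + t ^ 4) ^ 2 * (1 + μ₄)) + (1 + t ^ 4) ^ 2 * (96 * (1 + μ₄)) := by
            have h5 : 256 * w ^ 4 + 32 * μ₄ ≤ 96 * (1 + μ₄) := by linarith
            have h6 : 0 ≤ 256 * w ^ 4 + 32 * μ₄ := by rw [← h4]; positivity
            gcongr
        _ = _ := by ring
  · refine (integral_mono (h2t p) (h2i p) fun ω => truncatedMatrix_sq_le hτ.le _ _ _).trans ?_
    rw [integral_div, hW.second_moment]
    gcongr
    split_ifs <;> linarith
  · refine (integral_mono (h4t p) (h4i p)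
      fun ω => truncatedMatrix_pow_four_le hτ.le _ _ _).trans ?_
    rw [integral_div, hM.fourth]
    gcongr
    exact le_abs_self _

end Wigner

/-! ### Linear eigenvalue statistics -/

section LinearStatistic

open scoped FourierTransform

/-- The real spectral decomposition is pushed to complex matrices, where conjugation passes through
the exponential and the trace. -/
theorem traceExp_eq_sum {n : ℕ} {A : Matrix (Fin n) (Fin n) ℝ} (hA : A.IsHermitian) (t : ℝ) :
    traceExp A t = ∑ l, Complex.exp (Complex.I * t * hA.eigenvalues l) := by
  let U : Matrix (Fin n) (Fin n) ℝ := (hA.eigenvectorUnitary).1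
  have h1 : U * star U = 1 := Unitary.coe_mul_star_self hA.eigenvectorUnitary
  have h2 : star U * U = 1 := Unitary.coe_star_mul_self hA.eigenvectorUnitary
  let c : Matrix (Fin n) (Fin n) ℝ →+* Matrix (Fin n) (Fin n) ℂ := Complex.ofRealHom.mapMatrix
  let V : (Matrix (Fin n) (Fin n) ℂ)ˣ := ⟨c U, c (star U), by rw [← map_mul, h1, map_one],
    by rw [← map_mul, h2, map_one]⟩
  have hspec : A = U * Matrix.diagonal hA.eigenvalues * star U := by
    conv_lhs => rw [hA.spectral_theorem]
    rfl
  have hA' : A.map (fun x : ℝ => (x : ℂ))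
      = c U * Matrix.diagonal (fun l => (hA.eigenvalues l : ℂ)) * c (star U) := by
    have h3 : c A = c U * c (Matrix.diagonal hA.eigenvalues) * c (star U) := by
      rw [← map_mul, ← map_mul, ← hspec]
    have h4 : c (Matrix.diagonal hA.eigenvalues)
        = Matrix.diagonal (fun l => (hA.eigenvalues l : ℂ)) := by
      ext j k
      rcases eq_or_ne j k with rfl | h <;> simp_all [c]
    rw [← h4, ← h3]
    rfl
  have h5 : (Complex.I * (t : ℂ)) • A.map (fun x : ℝ => (x : ℂ))
      = (V : Matrix (Fin n) (Fin n) ℂ) *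
        Matrix.diagonal (fun l => Complex.I * t * hA.eigenvalues l) *
        ((V⁻¹ : (Matrix (Fin n) (Fin n) ℂ)ˣ) : Matrix (Fin n) (Fin n) ℂ) := by
    have h6 : Matrix.diagonal (fun l => Complex.I * t * (hA.eigenvalues l : ℂ))
        = (Complex.I * (t : ℂ)) • Matrix.diagonal (fun l => (hA.eigenvalues l : ℂ)) := by
      rw [← Matrix.diagonal_smul]
      rfl
    rw [h6, mul_smul_comm, smul_mul_assoc, hA']
    rfl
  rw [traceExp, h5, Matrix.exp_units_conj, Matrix.trace_units_conj, Matrix.exp_diagonal,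
    Matrix.trace_diagonal]
  simp [Complex.exp_eq_exp_ℂ]

/-- The Cauchy–Schwarz inequality with weights. -/
theorem sq_integral_mul_le {α : Type*} [MeasurableSpace α] {μ : Measure α} {g m v : α → ℝ}
    (hg : ∀ x, 0 ≤ g x) (hm : ∀ x, 0 < m x) (hgm : Integrable (fun x => g x * m x) μ)
    (hgv : Integrable (fun x => g x * v x) μ)
    (hgv2 : Integrable (fun x => g x * (v x ^ 2 / m x)) μ) :
    (∫ x, g x * v x ∂μ) ^ 2 ≤ (∫ x, g x * m x ∂μ) * ∫ x, g x * (v x ^ 2 / m x) ∂μ := by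
  -- This is the integral of `g (m s - v)² / m`, a nonnegative quadratic in `s`, so its discriminant
  -- is nonpositive.
  have h : ∀ s : ℝ, 0 ≤ (∫ x, g x * m x ∂μ) * (s * s) + (-2 * ∫ x, g x * v x ∂μ) * s
      + ∫ x, g x * (v x ^ 2 / m x) ∂μ := by
    intro s
    have h0 : 0 ≤ ∫ x, (g x * m x * (s * s) + (-2 * s) * (g x * v x)
        + g x * (v x ^ 2 / m x)) ∂μ := by
      refine integral_nonneg fun x => ?_
      have hx := (hm x).ne'
      have : g x * m x * (s * s) + (-2 * s) * (g x * v x) + g x * (v x ^ 2 / m x)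
          = g x * ((m x * s - v x) ^ 2 / m x) := by
        field_simp
        ring
      show 0 ≤ g x * m x * (s * s) + (-2 * s) * (g x * v x) + g x * (v x ^ 2 / m x)
      rw [this]
      exact mul_nonneg (hg x) (div_nonneg (sq_nonneg _) (hm x).le)
    rw [integral_add (f := fun x => g x * m x * (s * s) + (-2 * s) * (g x * v x))
      ((hgm.mul_const _).add (hgv.const_mul _)) hgv2,
      integral_add (hgm.mul_const _) (hgv.const_mul _), integral_mul_const,
      integral_const_mul] at h0
    linarith
  have := discrim_le_zero h
  rw [discrim] at this
  linarith

theorem one_le_one_add_abs_pow_four (t : ℝ) : 1 ≤ 1 + |t| ^ 4 :=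
  le_add_of_nonneg_right (by positivity)

theorem integrable_of_integrable_weight_smul {f : ℝ → ℂ}
    (hf : Integrable fun t : ℝ => (1 + |t| ^ 4) • f t) : Integrable f := by
  have hc : Continuous fun t : ℝ => (1 + |t| ^ 4)⁻¹ :=
    (continuous_const.add (continuous_abs.pow 4)).inv₀
      fun t => (zero_lt_one.trans_le (one_le_one_add_abs_pow_four t)).ne'
  have h := hf.bdd_smul (1 : ℝ) (φ := fun t : ℝ => (1 + |t| ^ 4)⁻¹) hc.aestronglyMeasurable
    (ae_of_all _ fun t => by
      rw [norm_inv, Real.norm_of_nonneg (by positivity)]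
      exact inv_le_one_of_one_le₀ (one_le_one_add_abs_pow_four t))
  refine h.congr (ae_of_all _ fun t => ?_)
  exact inv_smul_smul₀ (zero_lt_one.trans_le (one_le_one_add_abs_pow_four t)).ne' _

/-- A bounded random field integrated against a density: the standard deviation of the integral is
at most the integral of the standard deviations. -/
theorem complexVar_integral_mul_le {Ω : Type*} [MeasurableSpace Ω] (P : Measure Ω)
    [IsProbabilityMeasure P] {u : ℝ → Ω → ℂ} (hu : Measurable fun z : ℝ × Ω => u z.1 z.2)
    {K : ℝ} (hK : ∀ t ω, ‖u t ω‖ ≤ K) {f : ℝ → ℂ}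
    (hf : Integrable fun t : ℝ => (1 + |t| ^ 4) • f t) {C : ℝ}
    (hvar : ∀ t, complexVar (u t) P ≤ C * (1 + |t| ^ 4) ^ 2) :
    MemLp (fun ω => ∫ t, f t * u t ω) 2 P ∧
      complexVar (fun ω => ∫ t, f t * u t ω) P ≤ C * (∫ t : ℝ, (1 + |t| ^ 4) * ‖f t‖) ^ 2 := by
  have hfi : Integrable f := integrable_of_integrable_weight_smul hf
  have huω : ∀ ω, Measurable fun t => u t ω := fun ω =>
    hu.comp (measurable_id.prodMk measurable_const)
  have hui : Integrable (fun z : ℝ × Ω => f z.1 * u z.1 z.2) (volume.prod P) :=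
    (hfi.comp_fst P).mul_bdd (c := K) hu.aestronglyMeasurable (ae_of_all _ fun z => hK _ _)
  have hXm : AEStronglyMeasurable (fun ω => ∫ t, f t * u t ω) P :=
    hui.integral_prod_right.aestronglyMeasurable
  have hXb : ∀ ω, ‖∫ t, f t * u t ω‖ ≤ (∫ t, ‖f t‖) * K := fun ω => by
    rw [← integral_mul_const]
    refine norm_integral_le_of_norm_le (hfi.norm.mul_const K) (ae_of_all _ fun t => ?_)
    rw [norm_mul]
    exact mul_le_mul_of_nonneg_left (hK t ω) (norm_nonneg _)
  refine ⟨MemLp.of_bound hXm _ (ae_of_all _ hXb), ?_⟩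
  set I : ℝ := ∫ t : ℝ, (1 + |t| ^ 4) * ‖f t‖ with hI
  have hI0 : 0 ≤ I := integral_nonneg fun t => by positivity
  have hwi : Integrable fun t : ℝ => (1 + |t| ^ 4) * ‖f t‖ := by
    refine hf.norm.congr (ae_of_all _ fun t => ?_)
    simp only [norm_smul]
    rw [Real.norm_of_nonneg (by positivity)]
  set e : ℝ → ℂ := fun t => ∫ ω, u t ω ∂P with he
  have hem : Measurable e :=
    (StronglyMeasurable.integral_prod_right (f := u) hu.stronglyMeasurable).measurable
  have heb : ∀ t, ‖e t‖ ≤ K := fun t => by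
    simpa using norm_integral_le_of_norm_le_const (μ := P) (ae_of_all _ fun ω => hK t ω)
  have hmean : ∫ ω, (∫ t, f t * u t ω) ∂P = ∫ t, f t * e t := by
    rw [← integral_prod_symm _ hui, integral_prod _ hui]
    simp only [he, integral_const_mul]
  set v : ℝ → Ω → ℝ := fun t ω => ‖u t ω - e t‖ with hv
  have hvm : Measurable fun z : ℝ × Ω => v z.1 z.2 := (hu.sub (hem.comp measurable_fst)).norm
  have hv0 : ∀ t ω, 0 ≤ v t ω := fun t ω => norm_nonneg _
  have hvb : ∀ t ω, v t ω ≤ 2 * K := fun t ω => by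
    have := (norm_sub_le (u t ω) (e t)).trans (add_le_add (hK t ω) (heb t))
    linarith
  have hvω : ∀ ω, Measurable fun t => v t ω := fun ω =>
    hvm.comp (measurable_id.prodMk measurable_const)
  have hmm : Measurable fun t : ℝ => 1 + |t| ^ 4 := by fun_prop
  have hmp : ∀ t : ℝ, 0 < 1 + |t| ^ 4 := fun t => by positivity
  have hqm : Measurable fun z : ℝ × Ω => v z.1 z.2 ^ 2 / (1 + |z.1| ^ 4) :=
    (hvm.pow_const 2).div (hmm.comp measurable_fst)
  have hqb : ∀ t ω, ‖v t ω ^ 2 / (1 + |t| ^ 4)‖ ≤ (2 * K) ^ 2 := fun t ω => by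
    rw [Real.norm_of_nonneg (by positivity)]
    exact (div_le_self (sq_nonneg _) (one_le_one_add_abs_pow_four t)).trans
      (pow_le_pow_left₀ (hv0 t ω) (hvb t ω) 2)
  have hqi : Integrable (fun z : ℝ × Ω => ‖f z.1‖ * (v z.1 z.2 ^ 2 / (1 + |z.1| ^ 4)))
      (volume.prod P) :=
    (hfi.norm.comp_fst P).mul_bdd (c := (2 * K) ^ 2) hqm.aestronglyMeasurable
      (ae_of_all _ fun z => hqb _ _)
  -- Weighted Cauchy–Schwarz in `t` stands in for Minkowski's integral inequality: with the weight
  -- `1 + |t|⁴`, the mean of `v² / (1 + |t|⁴)` is at most `C (1 + |t|⁴)`, which reproduces the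
  -- integral `I`.
  have hpt : ∀ ω, ‖(∫ t, f t * u t ω) - ∫ ω', (∫ t, f t * u t ω') ∂P‖ ^ 2
      ≤ I * ∫ t, ‖f t‖ * (v t ω ^ 2 / (1 + |t| ^ 4)) := by
    intro ω
    have h1 : Integrable fun t => f t * u t ω :=
      hfi.mul_bdd (c := K) (huω ω).aestronglyMeasurable (ae_of_all _ fun t => hK t ω)
    have h2 : Integrable fun t => f t * e t :=
      hfi.mul_bdd (c := K) hem.aestronglyMeasurable (ae_of_all _ heb)
    have h3 : ‖(∫ t, f t * u t ω) - ∫ ω', (∫ t, f t * u t ω') ∂P‖ ≤ ∫ t, ‖f t‖ * v t ω := by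
      rw [hmean, ← integral_sub h1 h2]
      refine (norm_integral_le_integral_norm _).trans_eq ?_
      simp only [← mul_sub, norm_mul, hv]
    refine (pow_le_pow_left₀ (norm_nonneg _) h3 2).trans ?_
    have h4 := sq_integral_mul_le (μ := (volume : Measure ℝ)) (g := fun t => ‖f t‖)
      (m := fun t => 1 + |t| ^ 4) (v := fun t => v t ω) (fun t => norm_nonneg _) hmp
      (by simpa only [mul_comm] using hwi)
      (hfi.norm.mul_bdd (c := 2 * K) (hvω ω).aestronglyMeasurable (ae_of_all _ fun t => by
        rw [Real.norm_of_nonneg (hv0 t ω)]; exact hvb t ω))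
      (hfi.norm.mul_bdd (c := (2 * K) ^ 2)
        (((hvω ω).pow_const 2).div hmm).aestronglyMeasurable (ae_of_all _ fun t => hqb t ω))
    refine h4.trans_eq ?_
    simp only [hI, mul_comm]
  calc complexVar (fun ω => ∫ t, f t * u t ω) P
      ≤ ∫ ω, (I * ∫ t, ‖f t‖ * (v t ω ^ 2 / (1 + |t| ^ 4))) ∂P := by
        refine integral_mono_of_nonneg (ae_of_all _ fun ω => by positivity)
          (hqi.integral_prod_right.const_mul I) (ae_of_all _ hpt)
    _ = I * ∫ t, ∫ ω, ‖f t‖ * (v t ω ^ 2 / (1 + |t| ^ 4)) ∂P := by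
        rw [integral_const_mul, ← integral_prod_symm _ hqi, integral_prod _ hqi]
    _ ≤ I * ∫ t, C * ((1 + |t| ^ 4) * ‖f t‖) := by
        refine mul_le_mul_of_nonneg_left ?_ hI0
        refine integral_mono hqi.integral_prod_left (hwi.const_mul C) fun t => ?_
        show ∫ ω, ‖f t‖ * (v t ω ^ 2 / (1 + |t| ^ 4)) ∂P ≤ _
        rw [integral_const_mul, integral_div]
        have h := hvar t
        have h2 : (∫ ω, v t ω ^ 2 ∂P) / (1 + |t| ^ 4) ≤ C * (1 + |t| ^ 4) := by
          rw [div_le_iff₀ (hmp t)]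
          exact h.trans_eq (by ring)
        calc _ ≤ ‖f t‖ * (C * (1 + |t| ^ 4)) := by gcongr
          _ = _ := by ring
    _ = C * I ^ 2 := by rw [integral_const_mul]; ring

theorem linearStatistic_eq_integral {n : ℕ} {A : Matrix (Fin n) (Fin n) ℝ} (hA : A.IsHermitian)
    {φ f : ℝ → ℂ} (hφ : ∀ x : ℝ, φ x = ∫ t : ℝ, Complex.exp (Complex.I * t * x) * f t)
    (hf : Integrable f) : linearStatistic φ hA = ∫ t, f t * traceExp A t := by
  simp only [linearStatistic, hφ, traceExp_eq_sum hA, Finset.mul_sum]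
  rw [integral_finsetSum]
  · simp only [mul_comm]
  · intro l _
    refine hf.mul_bdd (c := 1) (by fun_prop) (ae_of_all _ fun t => ?_)
    rw [show Complex.I * t * hA.eigenvalues l = ((t * hA.eigenvalues l : ℝ) : ℂ) * Complex.I by
      push_cast; ring, Complex.norm_exp_ofReal_mul_I]

/-! ### Fourier inversion in the normalization of `fourierHat` -/

theorem fourierHat_eq (φ : ℝ → ℂ) (t : ℝ) :
    fourierHat φ t = (1 / (2 * Real.pi : ℂ)) * 𝓕 φ (t / (2 * Real.pi)) := by
  rw [fourierHat, Real.fourier_real_eq_integral_exp_smul]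
  congr 1
  refine integral_congr_ae (ae_of_all _ fun x => ?_)
  have hpi : (Real.pi : ℂ) ≠ 0 := by exact_mod_cast Real.pi_ne_zero
  simp only [smul_eq_mul]
  congr 2
  push_cast
  field_simp

theorem eq_integral_exp_mul_fourierHat {φ : ℝ → ℂ} (hc : Continuous φ) (hi : Integrable φ)
    (hh : Integrable (fourierHat φ)) (x : ℝ) :
    φ x = ∫ t : ℝ, Complex.exp (Complex.I * t * x) * fourierHat φ t := by
  have hpi : (Real.pi : ℂ) ≠ 0 := by exact_mod_cast Real.pi_ne_zero
  have hF : Integrable (𝓕 φ) := by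
    have h := (hh.comp_mul_left' (R := 2 * Real.pi) (by positivity)).const_mul (2 * Real.pi : ℂ)
    refine h.congr (ae_of_all _ fun ξ => ?_)
    simp only [fourierHat_eq]
    rw [mul_div_cancel_left₀ ξ (by positivity : (2 * Real.pi : ℝ) ≠ 0)]
    field_simp
  have h := congrFun (hc.fourierInv_fourier_eq hi hF) x
  rw [Real.fourierInv_eq'] at h
  rw [← h]
  -- The Jacobian `2π` of the substitution `ξ = t / 2π` cancels the prefactor of `fourierHat`.
  have h2 := Measure.integral_comp_div (fun ξ : ℝ => (1 / (2 * Real.pi : ℂ)) *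
    (Complex.exp (↑(2 * Real.pi * inner ℝ ξ x) * Complex.I) • 𝓕 φ ξ)) (2 * Real.pi)
  rw [abs_of_pos (by positivity)] at h2
  trans ∫ t : ℝ, (1 / (2 * Real.pi : ℂ)) * (Complex.exp
    (↑(2 * Real.pi * inner ℝ (t / (2 * Real.pi)) x) * Complex.I) • 𝓕 φ (t / (2 * Real.pi)))
  · rw [h2, integral_const_mul, Complex.real_smul, ← mul_assoc]
    push_cast
    rw [mul_one_div_cancel (by simp), one_mul]
  · refine integral_congr_ae (ae_of_all _ fun t => ?_)
    simp only [fourierHat_eq, smul_eq_mul]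
    have : ((2 * Real.pi * inner ℝ (t / (2 * Real.pi)) x : ℝ) : ℂ) * Complex.I
        = Complex.I * t * x := by
      simp only [RCLike.inner_apply, conj_trivial]
      push_cast
      field_simp
    rw [this]
    ring

end LinearStatistic

/-! ### Linear statistics of truncated Wigner matrices -/

section WignerStatistic

variable {Ω : ℕ → Type*} [∀ n, MeasurableSpace (Ω n)] {P : ∀ n, Measure (Ω n)}
  {W : ∀ n, Ω n → Matrix (Fin n) (Fin n) ℝ} {w μ₃ μ₄ : ℝ}

theorem IsWigner.measurable_traceExp (hW : IsWigner P w W) (τ : ℝ) (n : ℕ) :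
    Measurable fun z : ℝ × Ω n => traceExp (truncatedMatrix τ (W n z.2)) z.1 := by
  have h : Measurable fun z : ℝ × (UpperIndex n → ℝ) => traceExp (symmMatrix z.2) z.1 :=
    (continuous_traceExp.comp
      ((continuous_symmMatrix.comp continuous_snd).prodMk continuous_fst)).measurable
  have h2 : Measurable fun ω (p : UpperIndex n) => truncatedMatrix τ (W n ω) p.1.1 p.1.2 :=
    measurable_pi_lambda _ fun p => hW.measurable_truncatedMatrix τ n p.1.1 p.1.2
  convert! h.comp (measurable_fst.prodMk (h2.comp measurable_snd)) using 2 with z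
  exact congrArg (traceExp · z.1) (truncatedMatrix_eq_symmMatrix τ (hW.symm n z.2))

/-- The variance of a linear eigenvalue statistic of a truncated Wigner matrix, for a test function
that is the Fourier integral of `f`. -/
theorem IsWigner.complexVar_linearStatistic_le [∀ n, IsProbabilityMeasure (P n)]
    (hW : IsWigner P w W) (hM : HasMoments P W μ₃ μ₄) {τ : ℝ} (hτ : 0 < τ) (n : ℕ) {φ f : ℝ → ℂ}
    (hφ : ∀ x : ℝ, φ x = ∫ t : ℝ, Complex.exp (Complex.I * t * x) * f t)
    (hf : Integrable fun t : ℝ => (1 + |t| ^ 4) • f t) :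
    MemLp (fun ω => linearStatistic φ (truncatedMatrix_isHermitian τ (hW.symm n ω))) 2 (P n) ∧
      complexVar (fun ω => linearStatistic φ
        (truncatedMatrix_isHermitian τ (hW.symm n ω))) (P n)
        ≤ 128 * (1 + |μ₄|) * (∫ t : ℝ, (1 + |t| ^ 4) * ‖f t‖) ^ 2 := by
  simp only [linearStatistic_eq_integral _ hφ (integrable_of_integrable_weight_smul hf)]
  exact complexVar_integral_mul_le (P n)
    (u := fun t ω => traceExp (truncatedMatrix τ (W n ω)) t) (hW.measurable_traceExp τ n)
    (fun t ω => norm_traceExp_le (truncatedMatrix_isSymm τ (hW.symm n ω)) t) hf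
    (hW.complexVar_traceExp_le hM hτ n)

end WignerStatistic

theorem theorem3p5 :
    ∃ C : ℝ → ℝ → ℝ,
      ∀ (Ω : ℕ → Type*) [∀ n, MeasurableSpace (Ω n)] (P : ∀ n, Measure (Ω n))
        [∀ n, IsProbabilityMeasure (P n)]
        (W : ∀ n, Ω n → Matrix (Fin n) (Fin n) ℝ) (w μ₃ μ₄ : ℝ)
        (hW : IsWigner P w W),
        HasMoments P W μ₃ μ₄ →
        (∀ τ : ℝ, 0 < τ → Tendsto (lindebergFourth P W τ) atTop (𝓝 0)) →
        ∀ τ : ℝ, 0 < τ → ∀ n : ℕ,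
          -- the bound for the trace of the exponential
          (∀ t : ℝ,
            MemLp (fun ω => traceExp (truncatedMatrix τ (W n ω)) t) 2 (P n) ∧
            complexVar (fun ω => traceExp (truncatedMatrix τ (W n ω)) t) (P n)
              ≤ C τ μ₄ * (1 + |t| ^ 4) ^ 2) ∧
          -- the bound for linear statistics, with the Fourier transform given by its integral
          (∀ φ : ℝ → ℂ, Continuous φ → Integrable φ →
            Integrable (fun t : ℝ => (1 + |t| ^ 4) • fourierHat φ t) →
            MemLp (fun ω => linearStatistic φ
              (truncatedMatrix_isHermitian τ (hW.symm n ω))) 2 (P n) ∧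
            complexVar (fun ω => linearStatistic φ
              (truncatedMatrix_isHermitian τ (hW.symm n ω))) (P n)
              ≤ C τ μ₄ * (∫ t : ℝ, (1 + |t| ^ 4) * ‖fourierHat φ t‖) ^ 2) ∧
          -- the same for every test function, integrable or not, that is the Fourier integral
          -- of a density `φhat`
          (∀ φ φhat : ℝ → ℂ,
            (∀ x : ℝ, φ x = ∫ t : ℝ, Complex.exp (Complex.I * t * x) * φhat t) →
            Integrable (fun t : ℝ => (1 + |t| ^ 4) • φhat t) →
            MemLp (fun ω => linearStatistic φ
              (truncatedMatrix_isHermitian τ (hW.symm n ω))) 2 (P n) ∧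
            complexVar (fun ω => linearStatistic φ
              (truncatedMatrix_isHermitian τ (hW.symm n ω))) (P n)
              ≤ C τ μ₄ * (∫ t : ℝ, (1 + |t| ^ 4) * ‖φhat t‖) ^ 2) := by
  refine ⟨fun _ μ₄ => 128 * (1 + |μ₄|), ?_⟩
  intro Ω _ P _ W w μ₃ μ₄ hW hM _ τ hτ n
  refine ⟨fun t => ⟨?_, hW.complexVar_traceExp_le hM hτ n t⟩, fun φ hc hi hf => ?_,
    fun φ f hφ hf => hW.complexVar_linearStatistic_le hM hτ n hφ hf⟩
  · exact MemLp.of_bound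
      ((hW.measurable_traceExp τ n).comp
        (measurable_const.prodMk measurable_id)).aestronglyMeasurable n
      (ae_of_all _ fun ω => norm_traceExp_le (truncatedMatrix_isSymm τ (hW.symm n ω)) t)
  -- Fourier inversion reduces this case to that of a Fourier integral with density `fourierHat φ`.
  · exact hW.complexVar_linearStatistic_le hM hτ n
      (eq_integral_exp_mul_fourierHat hc hi (integrable_of_integrable_weight_smul hf)) hf
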